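/- For $d\ge 0$ let $\mathcal M_d$ be the algebra of complex $d\times d$ matrices. A quantum state is a positive semidefinite matrix of trace one; a quantum channel is a linear, completely positive, trace-preserving map. Let $\|A\|_1=\operatorname{Tr}\sqrt{A^\dagger A}$, and for a linear map $\Lambda$ between matrix algebras let $\|\Lambda\|_{1\to1}=\sup_{X\ne0}\|\Lambda(X)\|_1/\|X\|_1$. For states $\rho,\sigma$ let $D(\rho\|\sigma)=\operatorname{Tr}\big(\rho(\log_2\rho-\log_2\sigma)\big)$ if $\operatorname{supp}\rho\subseteq\operatorname{supp}\sigma$ (with $0\log_2 0=0$), and $D(\rho\|\sigma)=\infty$ otherwise. For a reference dimension $d_A$ and channels $T,S:\mathcal M_{d_{A'}}\to\mathcal M_{d_B}$ let $$D_{stab}(T\|S)=\sup_{\rho}D\big((\mathrm{id}\otimes T)(\rho)\,\big\|\,(\mathrm{id}\otimes S)(\rho)\big),$$ the supremum being over all quantum states $\rho\in\mathcal M_{d_A}\otimes\mathcal M_{d_{A'}}$, where $\mathrm{id}$ is the identity map of $\mathcal M_{d_A}$. **Theorem.** Let $d_A,d_{A'},d_B$ be arbitrary, let $\sigma\in\mathcal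 M_{d_B}$ be a quantum state with smallest eigenvalue $\lambda_{\min}(\sigma)$, let $R_\sigma:\mathcal M_{d_{A'}}\to\mathcal M_{d_B}$, $R_\sigma(X)=\operatorname{Tr}(X)\,\sigma$, be the replacer channel, and let $T:\mathcal M_{d_{A'}}\to\mathcal M_{d_B}$ be a quantum channel. If $\lambda_{\min}(\sigma)=0$, the bounds below are read with $c/0=\infty$ for $c>0$ and $\infty\cdot0=0$. 1. If $\|\mathrm{id}\otimes(T-R_\sigma)\|_{1\to1}\le\frac12$, with $\mathrm{id}$ the identity map of $\mathcal M_{d_A}$, then $$D_{stab}(T\|R_\sigma)\le\frac{2d_B^3}{\lambda_{\min}(\sigma)}\,\|\mathrm{id}\otimes(T-R_\sigma)\|_{1\to1}^2 .$$ 2. If $\|T-R_\sigma\|_{1\to1}\le\frac1{2d_B}$, then $$D_{stab}(T\|R_\sigma)\le\frac{2d_B^5}{\lambda_{\min}(\sigma)}\,\|T-R_\sigma\|_{1\to1}^2 .$$ -/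

import Mathlib

open scoped ENNReal Kronecker ComplexOrder

noncomputable section

/-- A quantum state: a positive semidefinite matrix of trace one. -/
def IsState {n : Type*} [Fintype n] (ρ : Matrix n n ℂ) : Prop :=
  ρ.PosSemidef ∧ ρ.trace = 1

/-- The Schatten `1`-norm `Tr √(Aᴴ A)`. -/
def traceNorm {n : Type*} [Fintype n] [DecidableEq n] (A : Matrix n n ℂ) : ℝ :=
  (cfc Real.sqrt (A.conjTranspose * A)).trace.re

/-- The induced `1 → 1` norm of a linear map between matrix algebras:
the supremum of `‖Λ X‖₁ / ‖X‖₁` over all `X ≠ 0`. -/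
def inducedTraceNorm {m n : Type*} [Fintype m] [DecidableEq m] [Fintype n] [DecidableEq n]
    (Λ : Matrix m m ℂ →ₗ[ℂ] Matrix n n ℂ) : ℝ≥0∞ :=
  ⨆ (X : Matrix m m ℂ) (_ : X ≠ 0), ENNReal.ofReal (traceNorm (Λ X) / traceNorm X)

/-- The map `id ⊗ Λ`, where `M_r ⊗ M_m` is identified with the matrices indexed by `r × m`:
`Λ` is applied to each of the blocks. -/
def idTensor (r : Type*) {m n : Type*} (Λ : Matrix m m ℂ →ₗ[ℂ] Matrix n n ℂ) :
    Matrix (r × m) (r × m) ℂ →ₗ[ℂ] Matrix (r × n) (r × n) ℂ where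
  toFun X := Matrix.of fun p q => Λ (Matrix.of fun a b => X (p.1, a) (q.1, b)) p.2 q.2
  map_add' X Y := by
    ext p q
    exact congrFun (congrFun (map_add Λ (Matrix.of fun a b => X (p.1, a) (q.1, b))
      (Matrix.of fun a b => Y (p.1, a) (q.1, b))) p.2) q.2
  map_smul' c X := by
    ext p q
    exact congrFun (congrFun (map_smul Λ c (Matrix.of fun a b => X (p.1, a) (q.1, b))) p.2) q.2

theorem idTensor_kronecker (r : Type*) {m n : Type*} (Λ : Matrix m m ℂ →ₗ[ℂ] Matrix n n ℂ)
    (A : Matrix r r ℂ) (B : Matrix m m ℂ) : idTensor r Λ (A ⊗ₖ B) = A ⊗ₖ Λ B := by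
  ext p q
  exact congrFun (congrFun (map_smul Λ (A p.1 q.1) B) p.2) q.2

/-- A quantum channel: a linear map that is completely positive and trace preserving. -/
def IsChannel {m n : Type*} [Fintype m] [Fintype n]
    (T : Matrix m m ℂ →ₗ[ℂ] Matrix n n ℂ) : Prop :=
  (∀ (r : ℕ) (X : Matrix (Fin r × m) (Fin r × m) ℂ),
      X.PosSemidef → (idTensor (Fin r) T X).PosSemidef) ∧
    ∀ X : Matrix m m ℂ, (T X).trace = X.trace

/-- The replacer channel `X ↦ Tr(X) σ`. -/
def replacer {m n : Type*} [Fintype m] (σ : Matrix n n ℂ) :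
    Matrix m m ℂ →ₗ[ℂ] Matrix n n ℂ :=
  (Matrix.traceLinearMap m ℂ ℂ).smulRight σ

theorem replacer_of_isState {m n : Type*} [Fintype m] (σ : Matrix n n ℂ) {ρ : Matrix m m ℂ}
    (hρ : IsState ρ) : replacer σ ρ = σ := by
  simp [replacer, hρ.2]

open Classical in
/-- The quantum relative entropy with logarithms to base `2`. The support of a Hermitian matrix
is its range. Since `Real.logb 2 0 = 0`, the matrix logarithms below vanish off the supports,
which is the convention `0 log 0 = 0`. -/
def relEntropy {n : Type*} [Fintype n] [DecidableEq n] (ρ σ : Matrix n n ℂ) : EReal :=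
  if LinearMap.range ρ.mulVecLin ≤ LinearMap.range σ.mulVecLin then
    (((ρ * (cfc (Real.logb 2) ρ - cfc (Real.logb 2) σ)).trace.re : ℝ) : EReal)
  else ⊤

/-- The stabilized channel divergence with reference system `M_r`: the supremum of
`D((id ⊗ T)(ρ) ‖ (id ⊗ S)(ρ))` over all states `ρ` of the reference and the input system. -/
def stabDivergence (r : Type*) {m n : Type*} [Fintype r] [DecidableEq r] [Fintype m]
    [Fintype n] [DecidableEq n] (T S : Matrix m m ℂ →ₗ[ℂ] Matrix n n ℂ) : EReal :=
  ⨆ (ρ : Matrix (r × m) (r × m) ℂ) (_ : IsState ρ),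
    relEntropy (idTensor r T ρ) (idTensor r S ρ)

/-- The smallest eigenvalue of a Hermitian matrix. -/
def minEigenvalue {n : Type*} [Fintype n] [DecidableEq n] {A : Matrix n n ℂ}
    (hA : A.IsHermitian) : ℝ :=
  ⨅ i, hA.eigenvalues i

end

noncomputable section

open Matrix

/-! In natural units, `log x ≤ x - 1` bounds D(τ‖ω) by the χ²-quantity Tr (τ-ω) ω⁻¹ (τ-ω), which is
quadratic in the deviation. It is also the supremum over Y of 2 Re Tr Y†(τ-ω) - Tr Y†ωY, a form that
needs no inverse and is the input of `relEntropy_le_of_quadratic_bound`. For the replacer, ω = ρ_A ⊗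
σ ≥ λ ρ_A ⊗ 1, so σ costs only a factor 1/λ. What remains is linear in ρ, and pure inputs suffice
(`BlockBound.quadratic_bound`).

A pure input is a matrix S with ρ_A = SS†. Write S = RW with W a partial isometry, K = R ⊗ 1 and Λ =
T - R_σ. Then (id ⊗ Λ) of the input is KJK† with J built from W alone, while ρ_A ⊗ 1 = KK†. The
weight thus absorbs one factor K, and the supremum is at most ‖JK†‖₂² ≤ ‖J‖² d_B ‖S‖₂². Vectors of
the output space have Schmidt rank at most d_B, so ‖J‖ ≤ d_B ε (`BlockBound.l2Sq_mulVec_le`). This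
gives d_B³ε², with no dependence on d_A.

The two parts differ only in the ε that controls matrix elements of id ⊗ Λ on rank one operators.
Without stabilization it grows by a factor d_B (`blockBound_of_inducedTraceNorm`), whence d_B⁵. The
constant 2 bounds 1/ln 2. -/

/-- The squared Euclidean norm of a complex vector. -/
def l2Sq {ι : Type*} [Fintype ι] (f : ι → ℂ) : ℝ :=
  ∑ i, ‖f i‖ ^ 2

/-- The entries of a matrix as a vector indexed by pairs. -/
def entryVec {m n : Type*} (A : Matrix m n ℂ) : m × n → ℂ :=
  fun p => A p.1 p.2

/-! ### Euclidean and Frobenius norms. -/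

section l2Sq

variable {ι m n : Type*} [Fintype ι] [Fintype m] [Fintype n]

theorem l2Sq_nonneg (f : ι → ℂ) : 0 ≤ l2Sq f :=
  Finset.sum_nonneg fun _ _ => by positivity

theorem l2Sq_star (f : ι → ℂ) : l2Sq (star f) = l2Sq f := by
  simp [l2Sq]

theorem l2Sq_eq_zero {f : ι → ℂ} : l2Sq f = 0 ↔ f = 0 := by
  rw [l2Sq, Finset.sum_eq_zero_iff_of_nonneg fun _ _ => by positivity]
  simp [funext_iff]

theorem star_dotProduct_self (f : ι → ℂ) : star f ⬝ᵥ f = (l2Sq f : ℂ) := by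
  simp only [dotProduct, l2Sq, Pi.star_apply, Complex.ofReal_sum, Complex.ofReal_pow]
  exact Finset.sum_congr rfl fun i _ => by
    rw [← Complex.conj_mul']
    rfl

theorem norm_dotProduct_sq_le (f g : ι → ℂ) : ‖f ⬝ᵥ g‖ ^ 2 ≤ l2Sq f * l2Sq g := by
  have h : ‖f ⬝ᵥ g‖ ≤ ∑ i, ‖f i‖ * ‖g i‖ :=
    (norm_sum_le _ _).trans_eq (by simp)
  exact (pow_le_pow_left₀ (norm_nonneg _) h 2).trans (Finset.sum_mul_sq_le_sq_mul_sq _ _ _)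

theorem l2Sq_entryVec (A : Matrix m n ℂ) : l2Sq (entryVec A) = ∑ i, l2Sq (A i) := by
  simp [l2Sq, entryVec, Fintype.sum_prod_type]

theorem l2Sq_entryVec_eq_sum_col (A : Matrix m n ℂ) :
    l2Sq (entryVec A) = ∑ j, l2Sq (fun i => A i j) := by
  rw [l2Sq_entryVec]
  exact Finset.sum_comm

theorem trace_conjTranspose_mul_self_eq (A : Matrix m n ℂ) :
    (Aᴴ * A).trace = (l2Sq (entryVec A) : ℂ) := by
  rw [l2Sq_entryVec_eq_sum_col, Complex.ofReal_sum]
  refine Finset.sum_congr rfl fun j _ => ?_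
  rw [← star_dotProduct_self]
  rfl

theorem trace_mul_conjTranspose_self_eq (A : Matrix m n ℂ) :
    (A * Aᴴ).trace = (l2Sq (entryVec A) : ℂ) := by
  rw [trace_mul_comm, trace_conjTranspose_mul_self_eq]

theorem l2Sq_mulVec_le (A : Matrix m n ℂ) (f : n → ℂ) :
    l2Sq (A *ᵥ f) ≤ l2Sq (entryVec A) * l2Sq f := by
  rw [l2Sq_entryVec, Finset.sum_mul]
  exact Finset.sum_le_sum fun i _ => norm_dotProduct_sq_le _ _

theorem l2Sq_mulVec_eq (A : Matrix m n ℂ) (f : n → ℂ) :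
    (l2Sq (A *ᵥ f) : ℂ) = star f ⬝ᵥ ((Aᴴ * A) *ᵥ f) := by
  rw [← star_dotProduct_self, star_mulVec, ← dotProduct_mulVec, mulVec_mulVec]

/-- Completing the square for the Frobenius inner product. -/
theorem two_mul_re_trace_sub_le (X Y : Matrix m n ℂ) :
    2 * (Xᴴ * Y).trace.re - l2Sq (entryVec X) ≤ l2Sq (entryVec Y) := by
  have h : (l2Sq (entryVec (X - Y)) : ℂ) = (l2Sq (entryVec X) : ℂ) + l2Sq (entryVec Y)
      - (Xᴴ * Y).trace - star (Xᴴ * Y).trace := by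
    rw [← trace_conjTranspose, conjTranspose_mul, conjTranspose_conjTranspose]
    simp only [← trace_conjTranspose_mul_self_eq, conjTranspose_sub, Matrix.sub_mul,
      Matrix.mul_sub, trace_sub]
    ring
  have h' := congrArg Complex.re h
  simp at h'
  have := l2Sq_nonneg (entryVec (X - Y))
  linarith

end l2Sq

/-! ### Trace norm: singular values, rank one operators, induced norm. -/

section Spectral

variable {m n : Type*} [Fintype m] [DecidableEq m] [Fintype n] [DecidableEq n]

/-- Unitary diagonalization, together with its effect on the functional calculus. -/
theorem Matrix.IsHermitian.exists_unitary_cfc {A : Matrix n n ℂ} (hA : A.IsHermitian) :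
    ∃ (U : Matrix n n ℂ) (e : n → ℝ), Uᴴ * U = 1 ∧ U * Uᴴ = 1 ∧
      A = U * diagonal (fun i => (e i : ℂ)) * Uᴴ ∧
      (∀ f : ℝ → ℝ, cfc f A = U * diagonal (fun i => (f (e i) : ℂ)) * Uᴴ) ∧
      (A.PosSemidef → ∀ i, 0 ≤ e i) := by
  refine ⟨hA.eigenvectorUnitary, hA.eigenvalues, Unitary.coe_star_mul_self _,
    Unitary.coe_mul_star_self _, ?_, fun f => ?_, fun h => h.eigenvalues_nonneg⟩
  · exact hA.spectral_theorem
  · rw [hA.cfc_eq]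
    rfl

theorem trace_unitary_diagonal {U : Matrix n n ℂ} (hU : Uᴴ * U = 1) (e : n → ℝ) :
    (U * diagonal (fun i => (e i : ℂ)) * Uᴴ).trace = ((∑ i, e i : ℝ) : ℂ) := by
  rw [trace_mul_comm, ← mul_assoc, hU, one_mul, trace_diagonal, Complex.ofReal_sum]

/-- Singular value description of the trace norm. -/
theorem exists_unitary_traceNorm_eq_sum (A : Matrix n n ℂ) :
    ∃ (U : Matrix n n ℂ) (e : n → ℝ), Uᴴ * U = 1 ∧ U * Uᴴ = 1 ∧
      Aᴴ * A = U * diagonal (fun i => (e i : ℂ)) * Uᴴ ∧ (∀ i, 0 ≤ e i) ∧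
      traceNorm A = ∑ i, √(e i) := by
  obtain ⟨U, e, hU, hU', h, hc, he⟩ := (isHermitian_conjTranspose_mul_self A).exists_unitary_cfc
  refine ⟨U, e, hU, hU', h, he (posSemidef_conjTranspose_mul_self A), ?_⟩
  rw [traceNorm, hc, trace_unitary_diagonal hU, Complex.ofReal_re]

theorem traceNorm_nonneg (A : Matrix n n ℂ) : 0 ≤ traceNorm A := by
  obtain ⟨U, e, -, -, -, -, h⟩ := exists_unitary_traceNorm_eq_sum A
  rw [h]
  exact Finset.sum_nonneg fun _ _ => Real.sqrt_nonneg _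

theorem l2Sq_mulVec_of_conjTranspose_mul_self {U : Matrix n n ℂ} (hU : Uᴴ * U = 1)
    (v : n → ℂ) : l2Sq (U *ᵥ v) = l2Sq v := by
  have := l2Sq_mulVec_eq U v
  rw [hU, one_mulVec, star_dotProduct_self] at this
  exact_mod_cast this

/-- The largest singular value is at most the sum of all of them. -/
theorem l2Sq_mulVec_le_traceNorm (A : Matrix n n ℂ) (v : n → ℂ) :
    l2Sq (A *ᵥ v) ≤ traceNorm A ^ 2 * l2Sq v := by
  obtain ⟨U, e, hU, hU', h, he, htr⟩ := exists_unitary_traceNorm_eq_sum A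
  have h1 : (l2Sq (A *ᵥ v) : ℂ) = ((∑ i, e i * ‖(Uᴴ *ᵥ v) i‖ ^ 2 : ℝ) : ℂ) := by
    have h2 : star v ᵥ* U = star (Uᴴ *ᵥ v) := by
      rw [star_mulVec, conjTranspose_conjTranspose]
    rw [l2Sq_mulVec_eq, h, ← mulVec_mulVec, ← mulVec_mulVec, dotProduct_mulVec, h2]
    simp only [dotProduct, mulVec_diagonal, Complex.ofReal_sum, Complex.ofReal_mul,
      Complex.ofReal_pow, Pi.star_apply]
    refine Finset.sum_congr rfl fun i _ => ?_
    rw [← Complex.conj_mul']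
    simp only [RCLike.star_def]
    ring
  have h3 : l2Sq (A *ᵥ v) = ∑ i, e i * ‖(Uᴴ *ᵥ v) i‖ ^ 2 := by exact_mod_cast h1
  have h4 : l2Sq (Uᴴ *ᵥ v) = l2Sq v :=
    l2Sq_mulVec_of_conjTranspose_mul_self (by rwa [conjTranspose_conjTranspose]) v
  rw [h3, ← h4, l2Sq, Finset.mul_sum]
  refine Finset.sum_le_sum fun i _ => mul_le_mul_of_nonneg_right ?_ (by positivity)
  have h5 : √(e i) ≤ traceNorm A := by
    rw [htr]
    exact Finset.single_le_sum (f := fun i => √(e i))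
      (fun _ _ => Real.sqrt_nonneg _) (Finset.mem_univ i)
  rw [← Real.sq_sqrt (he i)]
  exact pow_le_pow_left₀ (Real.sqrt_nonneg _) h5 2

theorem norm_star_dotProduct_mulVec_sq_le (A : Matrix n n ℂ) (u v : n → ℂ) :
    ‖star u ⬝ᵥ (A *ᵥ v)‖ ^ 2 ≤ traceNorm A ^ 2 * l2Sq u * l2Sq v := by
  have h := norm_dotProduct_sq_le (star u) (A *ᵥ v)
  have h' := mul_le_mul_of_nonneg_left (l2Sq_mulVec_le_traceNorm A v) (l2Sq_nonneg u)
  rw [l2Sq_star] at h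
  linarith

theorem traceNorm_eq_zero {A : Matrix n n ℂ} (h : traceNorm A = 0) : A = 0 := by
  refine ext_of_mulVec_single fun i => ?_
  have := l2Sq_mulVec_le_traceNorm A (Pi.single i 1)
  rw [h] at this
  rw [zero_mulVec]
  exact l2Sq_eq_zero.1 (le_antisymm (by linarith) (l2Sq_nonneg _))

/-- AᴴA is c times a projection, so its eigenvalues satisfy e² = ce and sum to c. Hence √c √e = e,
and summing gives √c ‖A‖₁ = c without locating the nonzero eigenvalue. -/
theorem traceNorm_vecMulVec_sq (φ ψ : n → ℂ) :
    traceNorm (vecMulVec φ (star ψ)) ^ 2 = l2Sq φ * l2Sq ψ := by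
  set A := vecMulVec φ (star ψ) with hAdef
  set c := l2Sq φ * l2Sq ψ with hc
  have hc0 : 0 ≤ c := mul_nonneg (l2Sq_nonneg _) (l2Sq_nonneg _)
  have hB : Aᴴ * A = (l2Sq φ : ℂ) • vecMulVec ψ (star ψ) := by
    rw [hAdef, conjTranspose_vecMulVec, star_star, vecMulVec_mul_vecMulVec, star_dotProduct_self]
    ext i j
    simp [vecMulVec_apply]
    ring
  have hBB : (Aᴴ * A) * (Aᴴ * A) = (c : ℂ) • (Aᴴ * A) := by
    rw [hB, smul_mul_smul_comm, vecMulVec_mul_vecMulVec, star_dotProduct_self, hc]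
    ext i j
    simp [vecMulVec_apply]
    ring
  obtain ⟨U, e, hU, hU', h, hnn, htr⟩ := exists_unitary_traceNorm_eq_sum A
  have hD : diagonal (fun i => (e i : ℂ)) = Uᴴ * (Aᴴ * A) * U := by
    rw [h]
    simp only [mul_assoc, hU, mul_one]
    rw [← mul_assoc, hU, one_mul]
  have hev : ∀ i, e i ^ 2 = c * e i := by
    intro i
    have h1 : diagonal (fun i => (e i : ℂ)) *
        diagonal (fun i => (e i : ℂ)) =
        (c : ℂ) • diagonal (fun i => (e i : ℂ)) := by
      have h3 : (c : ℂ) • (Uᴴ * (Aᴴ * A) * U) = Uᴴ * ((c : ℂ) • (Aᴴ * A)) * U := by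
        rw [mul_smul_comm, smul_mul_assoc]
      rw [hD, h3, ← hBB]
      simp only [mul_assoc]
      rw [← mul_assoc U Uᴴ, hU', one_mul]
    have h2 := congrFun (congrFun h1 i) i
    simp only [diagonal_mul_diagonal, diagonal_apply_eq, Matrix.smul_apply, smul_eq_mul] at h2
    rw [sq]
    exact_mod_cast h2
  have hsum : ∑ i, e i = c := by
    have h1 := trace_unitary_diagonal hU e
    rw [← h, hB, trace_smul, trace_vecMulVec, dotProduct_comm, star_dotProduct_self,
      smul_eq_mul] at h1
    rw [hc]
    exact_mod_cast h1.symm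
  have hsq : ∀ i, √c * √(e i) = e i := by
    intro i
    rw [← Real.sqrt_mul hc0, ← hev, Real.sqrt_sq (hnn i)]
  have hmul : √c * traceNorm A = c := by
    rw [htr, Finset.mul_sum, Finset.sum_congr rfl fun i _ => hsq i, hsum]
  rcases hc0.eq_or_lt with h0 | h0
  · have : ∀ i, e i = 0 := fun i => by
      have := hev i
      rw [← h0, zero_mul] at this
      exact pow_eq_zero_iff two_ne_zero |>.1 this
    rw [htr, ← h0]
    simp [this]
  · have h1 : traceNorm A = √c :=
      mul_left_cancel₀ (Real.sqrt_pos.2 h0).ne' (hmul.trans (Real.mul_self_sqrt hc0).symm)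
    rw [h1, Real.sq_sqrt hc0]

theorem traceNorm_le_inducedTraceNorm {Λ : Matrix m m ℂ →ₗ[ℂ] Matrix n n ℂ}
    (h : inducedTraceNorm Λ ≠ ⊤) (X : Matrix m m ℂ) :
    traceNorm (Λ X) ≤ (inducedTraceNorm Λ).toReal * traceNorm X := by
  by_cases hX : X = 0
  · subst hX
    have : traceNorm (0 : Matrix n n ℂ) = 0 := by
      have := traceNorm_vecMulVec_sq (0 : n → ℂ) 0
      have h0 : vecMulVec (0 : n → ℂ) (star (0 : n → ℂ)) = 0 := by
        ext i j
        simp [vecMulVec_apply]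
      rw [h0] at this
      simpa [l2Sq] using this
    rw [map_zero, this]
    exact mul_nonneg ENNReal.toReal_nonneg (traceNorm_nonneg _)
  · have hpos : 0 < traceNorm X :=
      (traceNorm_nonneg X).lt_of_ne fun h0 => hX (traceNorm_eq_zero h0.symm)
    have h1 : ENNReal.ofReal (traceNorm (Λ X) / traceNorm X) ≤ inducedTraceNorm Λ :=
      le_iSup₂_of_le X hX le_rfl
    rw [← div_le_iff₀ hpos]
    exact (ENNReal.ofReal_le_iff_le_toReal h).1 h1

theorem eq_zero_of_inducedTraceNorm_eq_zero {Λ : Matrix m m ℂ →ₗ[ℂ] Matrix n n ℂ}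
    (h : inducedTraceNorm Λ = 0) : Λ = 0 := by
  ext1 X
  refine traceNorm_eq_zero (le_antisymm ?_ (traceNorm_nonneg _))
  have := traceNorm_le_inducedTraceNorm (Λ := Λ) (by simp [h]) X
  simpa [h] using this

end Spectral

/-! ### Polar factorization and support projections. -/

section Polar

variable {r m n : Type*} [Fintype r] [DecidableEq r] [Fintype m] [Fintype n] [DecidableEq n]

/-- A polar-type factorization of `S` through a partial isometry. -/
theorem exists_polar_factorization (S : Matrix r m ℂ) :
    ∃ (R : Matrix r r ℂ) (W : Matrix r m ℂ) (p : r → ℝ), (∀ a, p a = 0 ∨ p a = 1) ∧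
      R * W = S ∧ R * Rᴴ = S * Sᴴ ∧ W * Wᴴ = diagonal (fun a => (p a : ℂ)) ∧
      diagonal (fun a => (p a : ℂ)) * Rᴴ = Rᴴ := by
  obtain ⟨U, e, hU, hU', h, -, he⟩ := (isHermitian_mul_conjTranspose_self S).exists_unitary_cfc
  replace he := he (posSemidef_self_mul_conjTranspose S)
  have hS' : (Uᴴ * S) * (Uᴴ * S)ᴴ = diagonal (fun a => (e a : ℂ)) := by
    rw [conjTranspose_mul, conjTranspose_conjTranspose, Matrix.mul_assoc,
      ← Matrix.mul_assoc S, h]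
    simp only [← Matrix.mul_assoc, hU, Matrix.one_mul]
    rw [Matrix.mul_assoc, hU, Matrix.mul_one]
  -- Where an eigenvalue of SSᴴ vanishes, so does the row of UᴴS; this makes the convention 0⁻¹ = 0
  -- harmless in the definition of W below.
  have hrow : ∀ a, e a = 0 → ∀ j, (Uᴴ * S) a j = 0 := by
    intro a ha j
    have h1 := congrFun (congrFun hS' a) a
    rw [diagonal_apply_eq, ha] at h1
    have h2 : ((Uᴴ * S) * (Uᴴ * S)ᴴ) a a = (l2Sq ((Uᴴ * S) a) : ℂ) := by
      rw [← star_dotProduct_self, dotProduct_comm]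
      rfl
    rw [h2, Complex.ofReal_inj, l2Sq_eq_zero] at h1
    exact congrFun h1 j
  set s : r → ℝ := fun a => √(e a) with hs
  have hss : ∀ a, s a * s a = e a := fun a => Real.mul_self_sqrt (he a)
  set p : r → ℝ := fun a => if e a = 0 then 0 else 1 with hp
  have hs0 : ∀ a, e a ≠ 0 → s a ≠ 0 := fun a ha h0 => ha (by rw [← hss, h0, zero_mul])
  refine ⟨U * diagonal (fun a => (s a : ℂ)), diagonal (fun a => ((s a)⁻¹ : ℂ)) * (Uᴴ * S), p,
    fun a => ?_, ?_, ?_, ?_, ?_⟩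
  · simp only [hp]
    split_ifs <;> simp
  · have h3 : diagonal (fun a => (s a : ℂ)) * (diagonal (fun a => ((s a)⁻¹ : ℂ)) * (Uᴴ * S)) =
        Uᴴ * S := by
      ext a j
      rw [diagonal_mul, diagonal_mul]
      by_cases ha : e a = 0
      · rw [hrow a ha j, mul_zero, mul_zero]
      · rw [← mul_assoc, mul_inv_cancel₀ (by exact_mod_cast hs0 a ha), one_mul]
    rw [Matrix.mul_assoc, h3, ← Matrix.mul_assoc, hU', Matrix.one_mul]
  · rw [conjTranspose_mul, diagonal_conjTranspose, h, ← Matrix.mul_assoc, Matrix.mul_assoc U,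
      diagonal_mul_diagonal]
    congr 3
    ext a
    simp [← hss]
  · rw [conjTranspose_mul, diagonal_conjTranspose, ← Matrix.mul_assoc, Matrix.mul_assoc _ (Uᴴ * S),
      hS', diagonal_mul_diagonal, diagonal_mul_diagonal]
    congr 1
    ext a
    by_cases ha : e a = 0
    · simp [hp, ha]
    · have h4 : (s a : ℂ) ≠ 0 := by exact_mod_cast hs0 a ha
      have h5 : (e a : ℂ) = s a * s a := by exact_mod_cast (hss a).symm
      simp only [hp, if_neg ha, h5]
      simp
      field_simp
  · rw [conjTranspose_mul, diagonal_conjTranspose, ← Matrix.mul_assoc, diagonal_mul_diagonal]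
    congr 2
    ext a
    by_cases ha : e a = 0
    · simp [hp, ha, hs]
    · simp [hp, ha]

omit [DecidableEq r] in
/-- A matrix with few columns is fixed by the adjoint of a matrix of small Frobenius norm. -/
theorem exists_support_matrix (V : Matrix r n ℂ) :
    ∃ Q : Matrix r r ℂ, Qᴴ * V = V ∧ l2Sq (entryVec Q) ≤ Fintype.card n := by
  obtain ⟨R, W, p, hp, hRW, -, hW, hR⟩ := exists_polar_factorization Vᴴ
  have hV : V = Wᴴ * Rᴴ := by
    rw [← conjTranspose_mul, hRW, conjTranspose_conjTranspose]
  -- The projection onto the column space of V, whose squared Frobenius norm is its rank.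
  refine ⟨Wᴴ * W, ?_, ?_⟩
  · rw [conjTranspose_mul, conjTranspose_conjTranspose, hV, Matrix.mul_assoc, ← Matrix.mul_assoc W,
      hW, hR]
  · have h1 : (l2Sq (entryVec (Wᴴ * W)) : ℂ) = ((∑ i, p i * p i : ℝ) : ℂ) := by
      rw [← trace_conjTranspose_mul_self_eq, conjTranspose_mul, conjTranspose_conjTranspose,
        Matrix.mul_assoc, trace_mul_comm, Matrix.mul_assoc, Matrix.mul_assoc, hW,
        ← Matrix.mul_assoc, hW, diagonal_mul_diagonal, trace_diagonal]
      push_cast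
      rfl
    rw [Complex.ofReal_inj.1 h1]
    calc ∑ i, p i * p i ≤ ∑ _i : n, (1 : ℝ) :=
          Finset.sum_le_sum fun i _ => by rcases hp i with h | h <;> simp [h]
      _ = Fintype.card n := by simp

theorem l2Sq_entryVec_mul_le (Q : Matrix r r ℂ) {W : Matrix r m ℂ} {p : r → ℝ}
    (hp : ∀ a, p a = 0 ∨ p a = 1) (hW : W * Wᴴ = diagonal (fun a => (p a : ℂ))) :
    l2Sq (entryVec (Q * W)) ≤ l2Sq (entryVec Q) := by
  have h1 : (l2Sq (entryVec (Q * W)) : ℂ) = (l2Sq (entryVec (Q * diagonal fun a => (p a : ℂ))) : ℂ) := by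
    rw [← trace_mul_conjTranspose_self_eq, ← trace_mul_conjTranspose_self_eq, conjTranspose_mul,
      conjTranspose_mul, Matrix.mul_assoc, ← Matrix.mul_assoc W, hW, Matrix.mul_assoc Q,
      ← Matrix.mul_assoc (diagonal _), diagonal_conjTranspose, diagonal_mul_diagonal]
    congr 4
    ext a
    rcases hp a with h | h <;> simp [h]
  rw [Complex.ofReal_inj.1 h1]
  refine Finset.sum_le_sum fun q _ => ?_
  simp only [entryVec, mul_diagonal]
  rcases hp q.2 with h | h <;> simp [h]

end Polar

/-! ### Matrix elements of id ⊗ Λ and the quadratic bound for pure inputs. -/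

section BlockBound

variable {r m n : Type*} [Fintype r] [DecidableEq r] [Fintype m] [DecidableEq m] [Fintype n]
  [DecidableEq n]

/-- The matrix elements of `id ⊗ Λ` on rank one operators are bounded by `ε`. -/
def BlockBound (r : Type*) [Fintype r] (Λ : Matrix m m ℂ →ₗ[ℂ] Matrix n n ℂ) (ε : ℝ) : Prop :=
  ∀ (φ ψ : r × m → ℂ) (u v : r × n → ℂ),
    ‖star u ⬝ᵥ (idTensor r Λ (vecMulVec φ (star ψ)) *ᵥ v)‖ ^ 2 ≤
      ε ^ 2 * (l2Sq φ * l2Sq ψ) * (l2Sq u * l2Sq v)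

theorem norm_star_dotProduct_map_vecMulVec_sq_le {Λ : Matrix m m ℂ →ₗ[ℂ] Matrix n n ℂ}
    (h : inducedTraceNorm Λ ≠ ⊤) (φ ψ : m → ℂ) (u v : n → ℂ) :
    ‖star u ⬝ᵥ (Λ (vecMulVec φ (star ψ)) *ᵥ v)‖ ^ 2 ≤
      (inducedTraceNorm Λ).toReal ^ 2 * (l2Sq φ * l2Sq ψ) * (l2Sq u * l2Sq v) := by
  refine (norm_star_dotProduct_mulVec_sq_le _ u v).trans ?_
  rw [mul_assoc]
  refine mul_le_mul_of_nonneg_right ?_ (mul_nonneg (l2Sq_nonneg _) (l2Sq_nonneg _))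
  rw [← traceNorm_vecMulVec_sq, ← mul_pow]
  exact pow_le_pow_left₀ (traceNorm_nonneg _) (traceNorm_le_inducedTraceNorm h _) 2

theorem blockBound_of_inducedTraceNorm_idTensor {Λ : Matrix m m ℂ →ₗ[ℂ] Matrix n n ℂ}
    (h : inducedTraceNorm (idTensor r Λ) ≠ ⊤) :
    BlockBound r Λ (inducedTraceNorm (idTensor r Λ)).toReal :=
  fun φ ψ u v => norm_star_dotProduct_map_vecMulVec_sq_le h φ ψ u v

-- Contracting the reference legs of u, v with those of φ, ψ leaves only Λ on rank one operators,
-- one for each pair of output indices. This is how the unstabilized norm enters.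
omit [DecidableEq r] [Fintype m] [DecidableEq m] [DecidableEq n] in
theorem star_dotProduct_idTensor_mulVec (Λ : Matrix m m ℂ →ₗ[ℂ] Matrix n n ℂ)
    (φ ψ : r × m → ℂ) (u v : r × n → ℂ) :
    star u ⬝ᵥ (idTensor r Λ (vecMulVec φ (star ψ)) *ᵥ v) =
      ∑ i, ∑ j, Λ (vecMulVec ((Matrix.of fun a' a => φ (a, a')) *ᵥ fun a => star (u (a, i)))
        (star ((Matrix.of fun b' b => ψ (b, b')) *ᵥ fun b => star (v (b, j))))) i j := by
  have h1 : ∀ i j, vecMulVec ((Matrix.of fun a' a => φ (a, a')) *ᵥ fun a => star (u (a, i)))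
        (star ((Matrix.of fun b' b => ψ (b, b')) *ᵥ fun b => star (v (b, j)))) =
      ∑ a, ∑ b, (star (u (a, i)) * v (b, j)) •
        (Matrix.of fun a' b' => vecMulVec φ (star ψ) (a, a') (b, b')) := by
    intro i j
    ext a' b'
    simp only [vecMulVec_apply, mulVec, dotProduct, Matrix.sum_apply, Matrix.smul_apply, of_apply,
      Pi.star_apply, star_sum, star_mul', star_star, smul_eq_mul, Finset.sum_mul_sum]
    exact Finset.sum_congr rfl fun a _ => Finset.sum_congr rfl fun b _ => by ring
  simp only [h1, map_sum, map_smul, Matrix.sum_apply, Matrix.smul_apply, smul_eq_mul]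
  simp only [dotProduct, mulVec, Fintype.sum_prod_type, Finset.mul_sum, Pi.star_apply]
  rw [Finset.sum_comm]
  refine Finset.sum_congr rfl fun i _ => ?_
  conv_rhs => rw [Finset.sum_comm]
  refine Finset.sum_congr rfl fun a _ => ?_
  rw [Finset.sum_comm]
  exact Finset.sum_congr rfl fun j _ => Finset.sum_congr rfl fun b _ => by
    simp only [idTensor, LinearMap.coe_mk, AddHom.coe_mk, of_apply]
    ring

omit [DecidableEq r] in
theorem blockBound_of_inducedTraceNorm {Λ : Matrix m m ℂ →ₗ[ℂ] Matrix n n ℂ}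
    (h : inducedTraceNorm Λ ≠ ⊤) :
    BlockBound r Λ (Fintype.card n * (inducedTraceNorm Λ).toReal) := by
  intro φ ψ u v
  set ε := (inducedTraceNorm Λ).toReal with hε
  set d : ℝ := (Fintype.card n : ℝ) with hd
  rw [star_dotProduct_idTensor_mulVec]
  set α : n → m → ℂ := fun i => (Matrix.of fun a' a => φ (a, a')) *ᵥ fun a => star (u (a, i))
    with hα
  set β : n → m → ℂ := fun j => (Matrix.of fun b' b => ψ (b, b')) *ᵥ fun b => star (v (b, j))
    with hβ
  have hvec : ∀ (θ : r × m → ℂ) (x : r × n → ℂ),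
      ∑ i, l2Sq ((Matrix.of fun a' a => θ (a, a')) *ᵥ fun a => star (x (a, i))) ≤
        l2Sq θ * l2Sq x := by
    intro θ x
    have h1 : l2Sq (entryVec (Matrix.of fun a' a => θ (a, a'))) = l2Sq θ := by
      rw [l2Sq_entryVec_eq_sum_col]
      simp [l2Sq, Fintype.sum_prod_type]
    have h2 : l2Sq x = ∑ i, l2Sq (fun a => star (x (a, i))) := by
      simp only [l2Sq, Fintype.sum_prod_type, norm_star]
      exact Finset.sum_comm
    rw [h2, Finset.mul_sum, ← h1]
    exact Finset.sum_le_sum fun i _ => l2Sq_mulVec_le _ _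
  have hentry : ∀ i j, ‖Λ (vecMulVec (α i) (star (β j))) i j‖ ^ 2 ≤
      ε ^ 2 * (l2Sq (α i) * l2Sq (β j)) := by
    intro i j
    have h3 := norm_star_dotProduct_map_vecMulVec_sq_le h (α i) (β j) (Pi.single i 1)
      (Pi.single j 1)
    have h4 : ∀ k : n, l2Sq (Pi.single k (1 : ℂ) : n → ℂ) = 1 := fun k => by
      rw [l2Sq, Finset.sum_eq_single k] <;> simp +contextual
    have h5 : star (Pi.single i (1 : ℂ) : n → ℂ) = Pi.single i 1 := by
      ext k
      by_cases hk : k = i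
      · subst hk
        simp
      · simp [hk]
    rw [h4, h4, mul_one, mul_one, h5, mulVec_single_one, single_one_dotProduct] at h3
    exact h3
  -- Cauchy–Schwarz over the d² index pairs is the source of the extra factor d.
  have hsum : ‖∑ i, ∑ j, Λ (vecMulVec (α i) (star (β j))) i j‖ ^ 2 ≤
      d ^ 2 * ∑ i, ∑ j, ‖Λ (vecMulVec (α i) (star (β j))) i j‖ ^ 2 := by
    rw [← Finset.sum_product', ← Finset.sum_product']
    refine (pow_le_pow_left₀ (norm_nonneg _) (norm_sum_le _ _) 2).trans ?_
    refine sq_sum_le_card_mul_sum_sq.trans (le_of_eq ?_)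
    rw [Finset.card_product, Finset.card_univ, hd, sq]
    push_cast
    rfl
  refine hsum.trans ?_
  have hbd : ∑ i, ∑ j, ‖Λ (vecMulVec (α i) (star (β j))) i j‖ ^ 2 ≤
      ε ^ 2 * ((l2Sq φ * l2Sq u) * (l2Sq ψ * l2Sq v)) := by
    calc ∑ i, ∑ j, ‖Λ (vecMulVec (α i) (star (β j))) i j‖ ^ 2
        ≤ ∑ i, ∑ j, ε ^ 2 * (l2Sq (α i) * l2Sq (β j)) :=
          Finset.sum_le_sum fun i _ => Finset.sum_le_sum fun j _ => hentry i j
      _ = ε ^ 2 * ((∑ i, l2Sq (α i)) * ∑ j, l2Sq (β j)) := by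
          rw [Finset.sum_mul_sum, Finset.mul_sum]
          exact Finset.sum_congr rfl fun i _ => by rw [Finset.mul_sum]
      _ ≤ _ := by
          refine mul_le_mul_of_nonneg_left ?_ (sq_nonneg _)
          exact mul_le_mul (hvec φ u) (hvec ψ v) (Finset.sum_nonneg fun _ _ => l2Sq_nonneg _)
            (mul_nonneg (l2Sq_nonneg _) (l2Sq_nonneg _))
  calc _ ≤ d ^ 2 * (ε ^ 2 * ((l2Sq φ * l2Sq u) * (l2Sq ψ * l2Sq v))) :=
        mul_le_mul_of_nonneg_left hbd (sq_nonneg _)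
    _ = _ := by ring

-- Operators on the reference system commute with id ⊗ Λ, so they can be moved between the input
-- vectors and the output.
omit [DecidableEq r] [Fintype m] [DecidableEq m] in
theorem idTensor_vecMulVec_entryVec_mul (Λ : Matrix m m ℂ →ₗ[ℂ] Matrix n n ℂ)
    (G H : Matrix r r ℂ) (W W' : Matrix r m ℂ) :
    idTensor r Λ (vecMulVec (entryVec (G * W)) (star (entryVec (H * W')))) =
      (G ⊗ₖ (1 : Matrix n n ℂ)) *
        idTensor r Λ (vecMulVec (entryVec W) (star (entryVec W'))) *
        (H ⊗ₖ (1 : Matrix n n ℂ))ᴴ := by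
  ext ⟨a, i⟩ ⟨b, j⟩
  have h1 : (Matrix.of fun a' b' => vecMulVec (entryVec (G * W)) (star (entryVec (H * W')))
      (a, a') (b, b')) = ∑ d, ∑ c, (G a c * star (H b d)) •
        (Matrix.of fun a' b' => vecMulVec (entryVec W) (star (entryVec W')) (c, a') (d, b')) := by
    ext a' b'
    simp only [vecMulVec_apply, entryVec, Matrix.mul_apply, Matrix.sum_apply, Matrix.smul_apply,
      of_apply, Pi.star_apply, star_sum, star_mul', smul_eq_mul, Finset.sum_mul_sum]
    rw [Finset.sum_comm]
    exact Finset.sum_congr rfl fun a _ => Finset.sum_congr rfl fun b _ => by ring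
  have h2 : idTensor r Λ (vecMulVec (entryVec (G * W)) (star (entryVec (H * W')))) (a, i) (b, j) =
      Λ (Matrix.of fun a' b' => vecMulVec (entryVec (G * W)) (star (entryVec (H * W')))
      (a, a') (b, b')) i j := rfl
  rw [h2, h1]
  simp only [map_sum, map_smul, Matrix.sum_apply, Matrix.smul_apply, smul_eq_mul,
    Matrix.mul_apply, Fintype.sum_prod_type, kroneckerMap_apply, conjTranspose_apply, one_apply,
    mul_ite, mul_one, mul_zero, ite_mul, zero_mul, Finset.sum_ite_eq, Finset.mem_univ, if_true,
    apply_ite star, star_zero, Finset.sum_mul]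
  exact Finset.sum_congr rfl fun d _ => Finset.sum_congr rfl fun c _ => by
    simp only [idTensor, LinearMap.coe_mk, AddHom.coe_mk, of_apply]
    ring

omit [DecidableEq r] in
theorem kronecker_one_mulVec_entryVec (G : Matrix r r ℂ) (V : Matrix r n ℂ) :
    (G ⊗ₖ (1 : Matrix n n ℂ)) *ᵥ entryVec V = entryVec (G * V) := by
  ext ⟨a, i⟩
  simp [mulVec, dotProduct, entryVec, Fintype.sum_prod_type, Matrix.mul_apply, one_apply]

omit [DecidableEq m] in
/-- Contractive compressions of the Choi matrix of `Λ` are bounded in operator norm. -/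
theorem BlockBound.l2Sq_mulVec_le {Λ : Matrix m m ℂ →ₗ[ℂ] Matrix n n ℂ} {ε : ℝ}
    (h : BlockBound r Λ ε) {W : Matrix r m ℂ} {p : r → ℝ} (hp : ∀ a, p a = 0 ∨ p a = 1)
    (hW : W * Wᴴ = diagonal (fun a => (p a : ℂ))) (v : r × n → ℂ) :
    l2Sq (idTensor r Λ (vecMulVec (entryVec W) (star (entryVec W))) *ᵥ v) ≤
      (Fintype.card n * ε) ^ 2 * l2Sq v := by
  set J := idTensor r Λ (vecMulVec (entryVec W) (star (entryVec W))) with hJ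
  set u := J *ᵥ v with hu
  set d : ℝ := (Fintype.card n : ℝ) with hd
  -- Since x has Schmidt rank at most d, a reference projection of rank at most d fixes it. Moving
  -- that projection onto W replaces W by an input vector of squared norm at most d, whatever the
  -- size of r.
  have hfix : ∀ x : r × n → ℂ, ∃ Q : Matrix r r ℂ, (Q ⊗ₖ (1 : Matrix n n ℂ))ᴴ *ᵥ x = x ∧
      l2Sq (entryVec (Q * W)) ≤ d := by
    intro x
    obtain ⟨Q, hQ, hQ'⟩ := exists_support_matrix (Matrix.of fun a i => x (a, i))
    refine ⟨Q, ?_, (l2Sq_entryVec_mul_le Q hp hW).trans hQ'⟩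
    have h1 := kronecker_one_mulVec_entryVec Qᴴ (Matrix.of fun a i => x (a, i))
    rw [hQ] at h1
    rw [conjTranspose_kronecker, conjTranspose_one]
    exact h1
  obtain ⟨P, hP, hP'⟩ := hfix u
  obtain ⟨Q, hQ, hQ'⟩ := hfix v
  have hb := h (entryVec (P * W)) (entryVec (Q * W)) u v
  have h2 : star u ⬝ᵥ (idTensor r Λ (vecMulVec (entryVec (P * W)) (star (entryVec (Q * W)))) *ᵥ v)
      = (l2Sq u : ℂ) := by
    rw [idTensor_vecMulVec_entryVec_mul, ← mulVec_mulVec, hQ, ← mulVec_mulVec, dotProduct_mulVec,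
      ← conjTranspose_conjTranspose (P ⊗ₖ (1 : Matrix n n ℂ)), ← star_mulVec, hP,
      star_dotProduct_self]
  rw [h2, Complex.norm_real, Real.norm_eq_abs, sq_abs] at hb
  have hu0 := l2Sq_nonneg u
  have hv0 := l2Sq_nonneg v
  have h3 : l2Sq u * l2Sq u ≤ ((d * ε) ^ 2 * l2Sq v) * l2Sq u := by
    rw [← sq]
    refine hb.trans ?_
    have h4 : l2Sq (entryVec (P * W)) * l2Sq (entryVec (Q * W)) ≤ d * d :=
      mul_le_mul hP' hQ' (l2Sq_nonneg _) (by positivity)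
    calc _ ≤ ε ^ 2 * (d * d) * (l2Sq u * l2Sq v) := by gcongr
      _ = _ := by ring
  rcases hu0.eq_or_lt with h0 | h0
  · rw [← h0]
    positivity
  · exact le_of_mul_le_mul_right h3 h0

-- The weight is KKᴴ and the deviation KJKᴴ, so in the variable KᴴZ the form is a completed square
-- bounded by ‖JKᴴ‖₂². Two factors card n come from ‖J‖², the third from the trace of the identity
-- in K = R ⊗ 1.
omit [DecidableEq m] in
theorem BlockBound.quadratic_bound_pure {Λ : Matrix m m ℂ →ₗ[ℂ] Matrix n n ℂ} {ε : ℝ}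
    (h : BlockBound r Λ ε) (S : Matrix r m ℂ) (Z : Matrix (r × n) (r × n) ℂ) :
    2 * (Zᴴ * idTensor r Λ (vecMulVec (entryVec S) (star (entryVec S)))).trace.re -
        (Zᴴ * ((S * Sᴴ) ⊗ₖ (1 : Matrix n n ℂ)) * Z).trace.re ≤
      Fintype.card n ^ 3 * ε ^ 2 * l2Sq (entryVec S) := by
  obtain ⟨R, W, p, hp, hRW, hRR, hW, -⟩ := exists_polar_factorization S
  set J := idTensor r Λ (vecMulVec (entryVec W) (star (entryVec W))) with hJ
  set K := R ⊗ₖ (1 : Matrix n n ℂ) with hK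
  have hKK : K * Kᴴ = (S * Sᴴ) ⊗ₖ (1 : Matrix n n ℂ) := by
    rw [hK, conjTranspose_kronecker, conjTranspose_one, ← mul_kronecker_mul, hRR, Matrix.one_mul]
  have hS : idTensor r Λ (vecMulVec (entryVec S) (star (entryVec S))) = K * J * Kᴴ := by
    rw [← hRW]
    exact idTensor_vecMulVec_entryVec_mul Λ R R W W
  have hX : (Zᴴ * ((S * Sᴴ) ⊗ₖ (1 : Matrix n n ℂ)) * Z).trace.re = l2Sq (entryVec (Kᴴ * Z)) := by
    rw [← Complex.ofReal_re (l2Sq _), ← trace_conjTranspose_mul_self_eq, conjTranspose_mul,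
      conjTranspose_conjTranspose, ← hKK]
    simp only [Matrix.mul_assoc]
  have hXY : Zᴴ * (K * J * Kᴴ) = (Kᴴ * Z)ᴴ * (J * Kᴴ) := by
    rw [conjTranspose_mul, conjTranspose_conjTranspose]
    simp only [Matrix.mul_assoc]
  rw [hS, hX, hXY]
  refine (two_mul_re_trace_sub_le _ _).trans ?_
  have hKn : l2Sq (entryVec Kᴴ) = Fintype.card n * l2Sq (entryVec S) := by
    have h1 : (l2Sq (entryVec Kᴴ) : ℂ) = ((Fintype.card n * l2Sq (entryVec S) : ℝ) : ℂ) := by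
      rw [← trace_conjTranspose_mul_self_eq, conjTranspose_conjTranspose, hKK, trace_kronecker,
        trace_mul_conjTranspose_self_eq, trace_one]
      push_cast
      ring
    exact_mod_cast h1
  calc l2Sq (entryVec (J * Kᴴ)) = ∑ q, l2Sq (J *ᵥ fun k => Kᴴ k q) := l2Sq_entryVec_eq_sum_col _
    _ ≤ ∑ q, (Fintype.card n * ε) ^ 2 * l2Sq (fun k => Kᴴ k q) :=
        Finset.sum_le_sum fun q _ => h.l2Sq_mulVec_le hp hW _
    _ = (Fintype.card n * ε) ^ 2 * l2Sq (entryVec Kᴴ) := by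
        rw [← Finset.mul_sum, ← l2Sq_entryVec_eq_sum_col]
    _ = _ := by
        rw [hKn]
        ring

end BlockBound

/-! ### Relative entropy bounded by a χ²-type quadratic form. -/

section Entropy

variable {n : Type*} [Fintype n] [DecidableEq n]

theorem trace_mul_diagonal_mul_diagonal_re (U V : Matrix n n ℂ) (a b : n → ℝ) :
    ((U * diagonal (fun i => (a i : ℂ)) * Uᴴ) * (V * diagonal (fun j => (b j : ℂ)) * Vᴴ)).trace.re
      = ∑ j, ∑ i, ‖(Vᴴ * U) j i‖ ^ 2 * (a i * b j) := by
  have h1 : ((U * diagonal (fun i => (a i : ℂ)) * Uᴴ) *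
      (V * diagonal (fun j => (b j : ℂ)) * Vᴴ)).trace =
      (((Vᴴ * U) * diagonal (fun i => (a i : ℂ))) *
        ((Vᴴ * U)ᴴ * diagonal (fun j => (b j : ℂ)))).trace := by
    rw [conjTranspose_mul, conjTranspose_conjTranspose]
    conv_rhs => rw [mul_assoc, mul_assoc, trace_mul_comm]
    simp only [mul_assoc]
  rw [h1, trace, Complex.re_sum]
  refine Finset.sum_congr rfl fun j _ => ?_
  rw [diag_apply, mul_apply, Complex.re_sum]
  refine Finset.sum_congr rfl fun i _ => ?_
  rw [mul_diagonal, mul_diagonal, conjTranspose_apply]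
  have : (Vᴴ * U) j i * (a i : ℂ) * (star ((Vᴴ * U) j i) * (b j : ℂ)) =
      ((‖(Vᴴ * U) j i‖ ^ 2 * (a i * b j) : ℝ) : ℂ) := by
    push_cast
    rw [← Complex.conj_mul']
    simp only [RCLike.star_def]
    ring
  rw [this, Complex.ofReal_re]

/-- If the quadratic form of `τ - ω` relative to `ω` is bounded by `C`, then the `χ²`-type sum in
the eigenbases is bounded by `C`, and so is the relative entropy in natural units. -/
theorem relEntropy_le_of_quadratic_bound {τ ω : Matrix n n ℂ} (hτ : τ.PosSemidef)
    (hω : ω.PosSemidef) (htr : τ.trace = ω.trace) {C : ℝ}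
    (hC : ∀ Y : Matrix n n ℂ,
      2 * (Yᴴ * (τ - ω)).trace.re - (Yᴴ * ω * Y).trace.re ≤ C) :
    relEntropy τ ω ≤ ((C / Real.log 2 : ℝ) : EReal) := by
  obtain ⟨U, t, hU, hU', hτU, hcτ, ht⟩ := hτ.isHermitian.exists_unitary_cfc
  obtain ⟨V, w, hV, hV', hωV, hcω, hw⟩ := hω.isHermitian.exists_unitary_cfc
  have ht0 := ht hτ
  have hw0 := hw hω
  set M := Vᴴ * U with hM
  -- The hypothesis at Y = VyUᴴ: in the two eigenbases the form decouples into one scalar quadratic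
  -- for each entry of y.
  have hquad : ∀ y : Matrix n n ℂ,
      ∑ j, ∑ i, (2 * (star (y j i) * (M j i * ((t i - w j : ℝ) : ℂ))).re
        - w j * ‖y j i‖ ^ 2) ≤ C := by
    intro y
    have h1 : ((V * y * Uᴴ)ᴴ * (τ - ω)).trace.re =
        ∑ j, ∑ i, (star (y j i) * (M j i * ((t i - w j : ℝ) : ℂ))).re := by
      have h2 : ((V * y * Uᴴ)ᴴ * (τ - ω)).trace =
          (yᴴ * (M * diagonal (fun i => (t i : ℂ)) - diagonal (fun i => (w i : ℂ)) * M)).trace := by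
        have h3 : Vᴴ * (τ - ω) = (M * diagonal (fun i => (t i : ℂ)) -
            diagonal (fun i => (w i : ℂ)) * M) * Uᴴ := by
          rw [mul_sub, sub_mul, hM, hτU, hωV]
          simp only [mul_assoc, hU', mul_one]
          rw [← mul_assoc Vᴴ V, hV, one_mul]
        rw [conjTranspose_mul, conjTranspose_mul, conjTranspose_conjTranspose, mul_assoc,
          mul_assoc, h3, trace_mul_comm, mul_assoc, mul_assoc, hU, mul_one]
      rw [h2, trace, Complex.re_sum, Finset.sum_comm]
      refine Finset.sum_congr rfl fun i _ => ?_
      rw [diag_apply, mul_apply, Complex.re_sum]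
      refine Finset.sum_congr rfl fun j _ => ?_
      rw [conjTranspose_apply, Matrix.sub_apply, mul_diagonal, diagonal_mul]
      congr 2
      push_cast
      ring
    have h4 : ((V * y * Uᴴ)ᴴ * ω * (V * y * Uᴴ)).trace.re = ∑ j, ∑ i, w j * ‖y j i‖ ^ 2 := by
      have h5 : ((V * y * Uᴴ)ᴴ * ω * (V * y * Uᴴ)).trace =
          (yᴴ * (diagonal (fun i => (w i : ℂ)) * y)).trace := by
        rw [conjTranspose_mul, conjTranspose_mul, conjTranspose_conjTranspose, hωV]
        rw [← mul_assoc, trace_mul_comm, ← mul_assoc]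
        simp only [mul_assoc]
        rw [← mul_assoc Uᴴ U, hU, one_mul, ← mul_assoc Vᴴ V, hV, one_mul, ← mul_assoc Vᴴ V, hV,
          one_mul]
      rw [h5, trace, Complex.re_sum, Finset.sum_comm]
      refine Finset.sum_congr rfl fun i _ => ?_
      rw [diag_apply, mul_apply, Complex.re_sum]
      refine Finset.sum_congr rfl fun j _ => ?_
      rw [conjTranspose_apply, diagonal_mul]
      have : star (y j i) * ((w j : ℂ) * y j i) = ((w j * ‖y j i‖ ^ 2 : ℝ) : ℂ) := by
        push_cast
        rw [← Complex.conj_mul']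
        simp only [RCLike.star_def]
        ring
      rw [this, Complex.ofReal_re]
    have h := hC (V * y * Uᴴ)
    rw [h1, h4] at h
    simpa only [Finset.sum_sub_distrib, Finset.mul_sum] using h
  -- Where w vanishes the form is purely linear in y, so a nonzero coefficient would make it
  -- unbounded; c is scaled so that the linear term equals |C| + 1 before doubling.
  have hker : ∀ j i, w j = 0 → M j i * (t i : ℂ) = 0 := by
    intro j i hj
    by_contra hne
    set z := M j i * (t i : ℂ) with hz
    have hpos : 0 < ‖z‖ ^ 2 := by positivity
    set c : ℝ := (|C| + 1) / ‖z‖ ^ 2 with hc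
    have h := hquad (Matrix.single j i ((c : ℂ) * z))
    rw [Finset.sum_eq_single j, Finset.sum_eq_single i] at h
    · rw [single_apply_same, hj, sub_zero, ← hz, zero_mul, sub_zero] at h
      have h6 : star ((c : ℂ) * z) * z = ((c * ‖z‖ ^ 2 : ℝ) : ℂ) := by
        push_cast
        rw [← Complex.conj_mul']
        simp only [star_mul', RCLike.star_def, Complex.conj_ofReal]
        ring
      rw [h6, Complex.ofReal_re, hc, div_mul_cancel₀ _ hpos.ne'] at h
      have := le_abs_self C
      have := abs_nonneg C
      linarith
    · intro i' _ hi'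
      simp [single_apply_of_col_ne _ _ hi'.symm]
    · simp
    · intro j' _ hj'
      refine Finset.sum_eq_zero fun i' _ => ?_
      simp [single_apply_of_row_ne hj'.symm]
    · simp
  -- Evaluation at the maximizer y = M(t - w)/w. Entries with w = 0 contribute zero on both sides
  -- because x/0 = 0.
  have hchi : ∑ j, ∑ i, ‖M j i‖ ^ 2 * ((t i - w j) ^ 2 / w j) ≤ C := by
    refine le_trans (le_of_eq ?_) (hquad (Matrix.of fun j i => M j i * (((t i - w j) / w j : ℝ) : ℂ)))
    refine Finset.sum_congr rfl fun j _ => Finset.sum_congr rfl fun i _ => ?_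
    have h7 : star (M j i * (((t i - w j) / w j : ℝ) : ℂ)) * (M j i * ((t i - w j : ℝ) : ℂ)) =
        ((‖M j i‖ ^ 2 * ((t i - w j) ^ 2 / w j) : ℝ) : ℂ) := by
      push_cast
      rw [← Complex.conj_mul']
      simp only [star_mul', RCLike.star_def, Complex.conj_ofReal, map_div₀, map_sub]
      ring
    rw [of_apply, h7, Complex.ofReal_re, norm_mul, Complex.norm_real, mul_pow, Real.norm_eq_abs,
      sq_abs]
    by_cases hj : w j = 0
    · simp [hj]
    · field_simp
      ring
  have hrange : LinearMap.range τ.mulVecLin ≤ LinearMap.range ω.mulVecLin := by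
    rintro _ ⟨x, rfl⟩
    -- The pseudo-inverse of ω, in its eigenbasis; `hker` gives ω ω⁺ τ = τ.
    set q : Matrix n n ℂ := diagonal (fun j => ((w j)⁻¹ : ℂ)) with hq
    refine ⟨(V * q * Vᴴ * τ) *ᵥ x, ?_⟩
    simp only [mulVecLin_apply, mulVec_mulVec]
    congr 1
    have h8 : diagonal (fun j => (w j : ℂ)) * (q * (M * diagonal (fun i => (t i : ℂ)))) =
        M * diagonal (fun i => (t i : ℂ)) := by
      ext j i
      rw [diagonal_mul, hq, diagonal_mul, mul_diagonal]
      by_cases hj : w j = 0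
      · rw [hker j i hj, mul_zero, mul_zero]
      · rw [← mul_assoc, mul_inv_cancel₀ (by exact_mod_cast hj), one_mul]
    have h9 : Vᴴ * τ = M * diagonal (fun i => (t i : ℂ)) * Uᴴ := by
      rw [hτU, hM]
      simp only [mul_assoc]
    have h10 : ω * (V * q * Vᴴ * τ) = V * (diagonal (fun j => (w j : ℂ)) *
        (q * (M * diagonal (fun i => (t i : ℂ))))) * Uᴴ := by
      rw [mul_assoc (V * q), h9, hωV]
      simp only [mul_assoc]
      rw [← mul_assoc Vᴴ V, hV, one_mul]
    rw [h10, h8, mul_assoc, ← h9, ← mul_assoc, hV', one_mul]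
  rw [relEntropy, if_pos hrange, EReal.coe_le_coe_iff, le_div_iff₀ (Real.log_pos one_lt_two)]
  have hone : (1 : Matrix n n ℂ) = V * diagonal (fun _ => ((1 : ℝ) : ℂ)) * Vᴴ := by
    simp [hV']
  have hone' : (1 : Matrix n n ℂ) = U * diagonal (fun _ => ((1 : ℝ) : ℂ)) * Uᴴ := by
    simp [hU']
  have hent : (τ * (cfc (Real.logb 2) τ - cfc (Real.logb 2) ω)).trace.re =
      ∑ j, ∑ i, ‖M j i‖ ^ 2 * (t i * (Real.logb 2 (t i) - Real.logb 2 (w j))) := by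
    have h11 : τ * cfc (Real.logb 2) τ =
        (U * diagonal (fun i => ((t i * Real.logb 2 (t i) : ℝ) : ℂ)) * Uᴴ) *
          (V * diagonal (fun _ => ((1 : ℝ) : ℂ)) * Vᴴ) := by
      rw [← hone, mul_one, hcτ]
      nth_rw 1 [hτU]
      simp only [Complex.ofReal_mul, mul_assoc]
      rw [← mul_assoc Uᴴ U, hU, one_mul, ← mul_assoc (diagonal _) (diagonal _),
        diagonal_mul_diagonal]
    rw [mul_sub, trace_sub, Complex.sub_re, h11, trace_mul_diagonal_mul_diagonal_re, hcω]
    nth_rw 1 [hτU]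
    rw [trace_mul_diagonal_mul_diagonal_re, ← Finset.sum_sub_distrib]
    refine Finset.sum_congr rfl fun j _ => ?_
    rw [← Finset.sum_sub_distrib]
    exact Finset.sum_congr rfl fun i _ => by ring
  -- By unitarity of M this is Tr τ - Tr ω; it removes the first-order term of the logarithm bound.
  have hlin : ∑ j, ∑ i, ‖M j i‖ ^ 2 * (t i - w j) = 0 := by
    have h12 : (τ * 1).trace.re = ∑ j, ∑ i, ‖M j i‖ ^ 2 * (t i * 1) := by
      rw [hone]
      nth_rw 1 [hτU]
      exact trace_mul_diagonal_mul_diagonal_re U V t fun _ => 1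
    have h13 : (1 * ω).trace.re = ∑ j, ∑ i, ‖M j i‖ ^ 2 * (1 * w j) := by
      rw [hone']
      nth_rw 1 [hωV]
      exact trace_mul_diagonal_mul_diagonal_re U V (fun _ => 1) w
    have h14 : (τ * 1).trace.re = (1 * ω).trace.re := by rw [mul_one, one_mul, htr]
    rw [h12, h13] at h14
    simp only [mul_sub, Finset.sum_sub_distrib]
    simp only [mul_one, one_mul] at h14
    rw [h14, sub_self]
  have hlog : ∀ x : ℝ, Real.logb 2 x * Real.log 2 = Real.log x := fun x =>
    div_mul_cancel₀ _ (Real.log_pos one_lt_two).ne'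
  rw [hent, Finset.sum_mul]
  calc ∑ j, (∑ i, ‖M j i‖ ^ 2 * (t i * (Real.logb 2 (t i) - Real.logb 2 (w j)))) * Real.log 2
      ≤ ∑ j, ∑ i, (‖M j i‖ ^ 2 * ((t i - w j) ^ 2 / w j) + ‖M j i‖ ^ 2 * (t i - w j)) := by
        refine Finset.sum_le_sum fun j _ => ?_
        rw [Finset.sum_mul]
        refine Finset.sum_le_sum fun i _ => ?_
        have h15 : ‖M j i‖ ^ 2 * (t i * (Real.logb 2 (t i) - Real.logb 2 (w j))) * Real.log 2 =
            ‖M j i‖ ^ 2 * (t i * (Real.log (t i) - Real.log (w j))) := by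
          rw [← hlog (t i), ← hlog (w j)]
          ring
        rw [h15, ← mul_add]
        by_cases hMz : M j i = 0
        · simp [hMz]
        refine mul_le_mul_of_nonneg_left ?_ (by positivity)
        rcases (hw0 j).eq_or_lt with hj | hj
        · have h16 := hker j i hj.symm
          have h17 : t i = 0 := by simpa [hMz] using h16
          simp [h17, ← hj]
        rcases (ht0 i).eq_or_lt with hi | hi
        · rw [← hi]
          field_simp
          simp
        -- With x = t/w, the bound log x ≤ x - 1 turns into t(t/w - 1) = (t - w)²/w + (t - w).
        · have h18 := Real.log_le_sub_one_of_pos (div_pos hi hj)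
          rw [Real.log_div hi.ne' hj.ne'] at h18
          refine (mul_le_mul_of_nonneg_left h18 hi.le).trans (le_of_eq ?_)
          field_simp
          ring
    _ ≤ C := by
        simp only [Finset.sum_add_distrib]
        rw [hlin, add_zero]
        exact hchi

end Entropy

/-! ### Reduction to pure inputs and comparison with the replacer output. -/

section Channel

variable {r m n : Type*} [Fintype r] [DecidableEq r] [Fintype m] [DecidableEq m] [Fintype n]
  [DecidableEq n]

/-- The reduced operator on the reference system. -/
def refTrace (ρ : Matrix (r × m) (r × m) ℂ) : Matrix r r ℂ :=
  ∑ k, ρ.submatrix (fun a => (a, k)) (fun a => (a, k))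

omit [Fintype r] [DecidableEq r] [DecidableEq m] in
theorem refTrace_posSemidef {ρ : Matrix (r × m) (r × m) ℂ} (hρ : ρ.PosSemidef) :
    (refTrace ρ).PosSemidef :=
  posSemidef_sum _ fun _ _ => hρ.submatrix _

omit [Fintype r] [DecidableEq r] [DecidableEq m] [Fintype n] [DecidableEq n] in
theorem idTensor_replacer (σ : Matrix n n ℂ) (ρ : Matrix (r × m) (r × m) ℂ) :
    idTensor r (replacer σ) ρ = refTrace ρ ⊗ₖ σ := by
  ext p q
  simp [idTensor, replacer, refTrace, trace, Matrix.sum_apply]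

omit [DecidableEq r] [DecidableEq m] [DecidableEq n] in
theorem trace_idTensor {T : Matrix m m ℂ →ₗ[ℂ] Matrix n n ℂ}
    (hT : ∀ X, (T X).trace = X.trace) (ρ : Matrix (r × m) (r × m) ℂ) :
    (idTensor r T ρ).trace = ρ.trace := by
  simp only [trace, Fintype.sum_prod_type]
  exact Finset.sum_congr rfl fun a _ => hT (Matrix.of fun k l => ρ (a, k) (a, l))

omit [Fintype r] [DecidableEq r] [Fintype m] [DecidableEq m] [Fintype n] [DecidableEq n] in
theorem idTensor_sub_apply (T S : Matrix m m ℂ →ₗ[ℂ] Matrix n n ℂ)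
    (ρ : Matrix (r × m) (r × m) ℂ) :
    idTensor r (T - S) ρ = idTensor r T ρ - idTensor r S ρ := rfl

omit [Fintype r] [DecidableEq r] [DecidableEq m] in
theorem refTrace_vecMulVec (S : Matrix r m ℂ) :
    refTrace (vecMulVec (entryVec S) (star (entryVec S))) = S * Sᴴ := by
  ext a b
  simp [refTrace, Matrix.sum_apply, vecMulVec_apply, entryVec, Matrix.mul_apply]

open scoped MatrixOrder in
theorem Matrix.PosSemidef.exists_sum_vecMulVec {ι : Type*} [Fintype ι] [DecidableEq ι]
    {ρ : Matrix ι ι ℂ} (hρ : ρ.PosSemidef) :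
    ∃ φ : ι → ι → ℂ, ρ = ∑ k, vecMulVec (φ k) (star (φ k)) := by
  obtain ⟨B, rfl⟩ := CStarAlgebra.nonneg_iff_eq_star_mul_self.mp hρ.nonneg
  refine ⟨fun k => star (B k), ?_⟩
  ext i j
  simp [Matrix.mul_apply, star_eq_conjTranspose, Matrix.sum_apply, vecMulVec_apply]

/-- For fixed Z every term is linear in ρ, so the bounds for the rank one summands of ρ add up. -/
theorem BlockBound.quadratic_bound {Λ : Matrix m m ℂ →ₗ[ℂ] Matrix n n ℂ} {ε : ℝ}
    (h : BlockBound r Λ ε) {ρ : Matrix (r × m) (r × m) ℂ} (hρ : ρ.PosSemidef)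
    (Z : Matrix (r × n) (r × n) ℂ) :
    2 * (Zᴴ * idTensor r Λ ρ).trace.re -
        (Zᴴ * (refTrace ρ ⊗ₖ (1 : Matrix n n ℂ)) * Z).trace.re ≤
      Fintype.card n ^ 3 * ε ^ 2 * ρ.trace.re := by
  obtain ⟨φ, hφ⟩ := hρ.exists_sum_vecMulVec
  set S : r × m → Matrix r m ℂ := fun k => Matrix.of fun a b => φ k (a, b) with hS
  have hφS : ρ = ∑ k, vecMulVec (entryVec (S k)) (star (entryVec (S k))) := hφ
  have hk := Finset.sum_le_sum fun k (_ : k ∈ Finset.univ) => h.quadratic_bound_pure (S k) Z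
  have h1 : idTensor r Λ ρ =
      ∑ k, idTensor r Λ (vecMulVec (entryVec (S k)) (star (entryVec (S k)))) := by
    conv_lhs => rw [hφS]
    rw [map_sum]
  have h2 : refTrace ρ ⊗ₖ (1 : Matrix n n ℂ) =
      ∑ k, (S k * (S k)ᴴ) ⊗ₖ (1 : Matrix n n ℂ) := by
    simp only [← refTrace_vecMulVec, ← idTensor_replacer]
    rw [← map_sum, ← hφS]
  have h3 : ρ.trace.re = ∑ k, l2Sq (entryVec (S k)) := by
    conv_lhs => rw [hφS]
    rw [trace_sum, Complex.re_sum]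
    refine Finset.sum_congr rfl fun k _ => ?_
    rw [trace_vecMulVec, dotProduct_comm, star_dotProduct_self, Complex.ofReal_re]
  rw [h1, h2, h3]
  refine le_trans (le_of_eq ?_) (hk.trans_eq (Finset.mul_sum _ _ _).symm)
  rw [Finset.sum_sub_distrib, ← Finset.mul_sum]
  simp only [Matrix.mul_sum, Matrix.sum_mul, trace_sum, Complex.re_sum]

theorem relEntropy_idTensor_replacer_le {T : Matrix m m ℂ →ₗ[ℂ] Matrix n n ℂ}
    (hTpos : ∀ X : Matrix (r × m) (r × m) ℂ, X.PosSemidef → (idTensor r T X).PosSemidef)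
    (hTtr : ∀ X, (T X).trace = X.trace) {σ : Matrix n n ℂ} (hσ : IsState σ) {lam : ℝ}
    (hlam : 0 < lam) (hσl : (σ - (lam : ℂ) • (1 : Matrix n n ℂ)).PosSemidef) {ε : ℝ}
    (h : BlockBound r (T - replacer σ) ε) {ρ : Matrix (r × m) (r × m) ℂ} (hρ : IsState ρ) :
    relEntropy (idTensor r T ρ) (idTensor r (replacer σ) ρ) ≤
      ((2 * Fintype.card n ^ 3 / lam * ε ^ 2 : ℝ) : EReal) := by
  have hA := refTrace_posSemidef hρ.1
  have htr : (idTensor r T ρ).trace = (idTensor r (replacer σ) ρ).trace := by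
    rw [trace_idTensor hTtr, trace_idTensor]
    intro X
    simp [replacer, hσ.2]
  set C : ℝ := Fintype.card n ^ 3 * ε ^ 2 with hCdef
  refine (relEntropy_le_of_quadratic_bound (C := C / lam) (hTpos ρ hρ.1) ?_ htr fun Y => ?_).trans ?_
  · rw [idTensor_replacer]
    exact hA.kronecker hσ.1
  · have h1 := h.quadratic_bound hρ.1 ((lam : ℂ) • Y)
    -- Rescaling the test matrix by λ gives the weight λ²(ρ_A ⊗ 1). As λ(ρ_A ⊗ 1) ≤ ρ_A ⊗ σ,
    -- dividing by λ yields the form with weight ρ_A ⊗ σ and bound C/λ.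
    rw [hρ.2, Complex.one_re, mul_one] at h1
    have h2 : 0 ≤ (Yᴴ * (refTrace ρ ⊗ₖ (σ - (lam : ℂ) • (1 : Matrix n n ℂ))) * Y).trace.re :=
      (Complex.nonneg_iff.1
        ((hA.kronecker hσl).conjTranspose_mul_mul_same Y).trace_nonneg).1
    have h3 : refTrace ρ ⊗ₖ (σ - (lam : ℂ) • (1 : Matrix n n ℂ)) =
        refTrace ρ ⊗ₖ σ - (lam : ℂ) • (refTrace ρ ⊗ₖ (1 : Matrix n n ℂ)) := by
      ext p q
      simp only [kroneckerMap_apply, Matrix.sub_apply, Matrix.smul_apply, smul_eq_mul]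
      ring
    rw [h3, Matrix.mul_sub, Matrix.sub_mul, trace_sub, Complex.sub_re] at h2
    simp only [conjTranspose_smul, Matrix.smul_mul, Matrix.mul_smul, trace_smul, smul_eq_mul,
      RCLike.star_def, Complex.conj_ofReal, Complex.re_ofReal_mul] at h1 h2
    rw [← idTensor_sub_apply, idTensor_replacer, le_div_iff₀ hlam]
    nlinarith [mul_le_mul_of_nonneg_left h2 hlam.le]
  · rw [EReal.coe_le_coe_iff]
    have hC0 : 0 ≤ C / lam := by positivity
    have hlog : (1 / 2 : ℝ) ≤ Real.log 2 := by linarith [Real.log_two_gt_d9]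
    calc C / lam / Real.log 2 ≤ C / lam / (1 / 2) := by gcongr
      _ = _ := by
        rw [hCdef]
        ring

theorem relEntropy_self (ρ : Matrix n n ℂ) : relEntropy ρ ρ = 0 := by
  simp [relEntropy]

theorem minEigenvalue_nonneg {σ : Matrix n n ℂ} (hσ : σ.PosSemidef) :
    0 ≤ minEigenvalue hσ.isHermitian :=
  Real.iInf_nonneg fun i => hσ.eigenvalues_nonneg i

theorem sub_minEigenvalue_smul_posSemidef {σ : Matrix n n ℂ} (hσ : σ.IsHermitian) :
    (σ - (minEigenvalue hσ : ℂ) • (1 : Matrix n n ℂ)).PosSemidef := by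
  set U : Matrix n n ℂ := (hσ.eigenvectorUnitary : Matrix n n ℂ) with hU
  have hUU : U * Uᴴ = 1 := Unitary.coe_mul_star_self _
  have h : σ = U * diagonal (fun i => (hσ.eigenvalues i : ℂ)) * Uᴴ := hσ.spectral_theorem
  have h1 : σ - (minEigenvalue hσ : ℂ) • (1 : Matrix n n ℂ) =
      U * diagonal (fun i => ((hσ.eigenvalues i - minEigenvalue hσ : ℝ) : ℂ)) * Uᴴ := by
    have h2 : diagonal (fun i => ((hσ.eigenvalues i - minEigenvalue hσ : ℝ) : ℂ)) =
        diagonal (fun i => (hσ.eigenvalues i : ℂ)) -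
          (minEigenvalue hσ : ℂ) • (1 : Matrix n n ℂ) := by
      rw [smul_one_eq_diagonal, diagonal_sub]
      simp
    rw [h2, Matrix.mul_sub, Matrix.sub_mul, ← h, Matrix.mul_smul, Matrix.smul_mul, Matrix.mul_one,
      hUU]
  rw [h1]
  refine PosSemidef.mul_mul_conjTranspose_same (PosSemidef.diagonal fun i => ?_) U
  simp only [Pi.zero_apply, Complex.zero_le_real, sub_nonneg]
  exact ciInf_le (Set.finite_range _).bddBelow i

/-- The common form of both bounds: `N` is a channel distance that dominates the matrix elements
of `id ⊗ (T - R_σ)` up to the factor `c`. -/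
theorem stabDivergence_replacer_le {T : Matrix m m ℂ →ₗ[ℂ] Matrix n n ℂ}
    (hTpos : ∀ X : Matrix (r × m) (r × m) ℂ, X.PosSemidef → (idTensor r T X).PosSemidef)
    (hTtr : ∀ X, (T X).trace = X.trace) {σ : Matrix n n ℂ} (hσ : IsState σ) {N : ℝ≥0∞}
    (hN : N ≠ ⊤) {c : ℕ} (hzero : N = 0 → idTensor r (T - replacer σ) = 0)
    (h : BlockBound r (T - replacer σ) ((Fintype.card n : ℝ) ^ c * N.toReal)) :
    stabDivergence r T (replacer σ) ≤
      ((2 * (Fintype.card n : ℝ≥0∞) ^ (3 + 2 * c) /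
        ENNReal.ofReal (minEigenvalue hσ.1.isHermitian) * N ^ 2 : ℝ≥0∞) : EReal) := by
  refine iSup₂_le fun ρ hρ => ?_
  set lam := minEigenvalue hσ.1.isHermitian with hlamdef
  have hn : Fintype.card n ≠ 0 := by
    intro h0
    have := Fintype.card_eq_zero_iff.1 h0
    have h1 := hσ.2
    simp [trace] at h1
  rcases (minEigenvalue_nonneg hσ.1).eq_or_lt with hlam | hlam
  -- For singular σ the bound is ∞ unless N = 0; then ∞ · 0 = 0, and the two outputs coincide.
  · by_cases hN0 : N = 0
    · have h1 : idTensor r T ρ = idTensor r (replacer σ) ρ := by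
        rw [← sub_eq_zero, ← idTensor_sub_apply, hzero hN0, LinearMap.zero_apply]
      rw [h1, relEntropy_self]
      exact EReal.coe_ennreal_nonneg _
    · rw [hlamdef, ← hlam, ENNReal.ofReal_zero, ENNReal.div_zero, ENNReal.top_mul]
      · exact le_top
      · exact pow_ne_zero 2 hN0
      · exact mul_ne_zero two_ne_zero (pow_ne_zero _ (by exact_mod_cast hn))
  · refine (relEntropy_idTensor_replacer_le hTpos hTtr hσ hlam
      (sub_minEigenvalue_smul_posSemidef hσ.1.isHermitian) h hρ).trans (le_of_eq ?_)
    have h2 : (2 * (Fintype.card n : ℝ≥0∞) ^ (3 + 2 * c) / ENNReal.ofReal lam * N ^ 2 : ℝ≥0∞) =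
        ENNReal.ofReal (2 * (Fintype.card n : ℝ) ^ 3 / lam *
          ((Fintype.card n : ℝ) ^ c * N.toReal) ^ 2) := by
      have h3 : 2 * (Fintype.card n : ℝ) ^ 3 / lam * ((Fintype.card n : ℝ) ^ c * N.toReal) ^ 2 =
          2 * (Fintype.card n : ℝ) ^ (3 + 2 * c) / lam * N.toReal ^ 2 := by
        ring
      rw [h3, ENNReal.ofReal_mul (by positivity), ENNReal.ofReal_div_of_pos hlam,
        ENNReal.ofReal_mul (by norm_num), ENNReal.ofReal_pow (by positivity),
        ENNReal.ofReal_pow ENNReal.toReal_nonneg, ENNReal.ofReal_toReal hN,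
        ENNReal.ofReal_natCast, ENNReal.ofReal_ofNat]
    rw [h2, EReal.coe_ennreal_ofReal, max_eq_left (by positivity)]

end Channel

end

theorem mainTheorem8 (dA dA' dB : ℕ) (σ : Matrix (Fin dB) (Fin dB) ℂ) (hσ : IsState σ)
    (T : Matrix (Fin dA') (Fin dA') ℂ →ₗ[ℂ] Matrix (Fin dB) (Fin dB) ℂ) (hT : IsChannel T) :
    (inducedTraceNorm (idTensor (Fin dA) (T - replacer σ)) ≤ 1 / 2 →
      stabDivergence (Fin dA) T (replacer σ) ≤
        ((2 * (dB : ℝ≥0∞) ^ 3 / ENNReal.ofReal (minEigenvalue hσ.1.isHermitian) *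
          inducedTraceNorm (idTensor (Fin dA) (T - replacer σ)) ^ 2 : ℝ≥0∞) : EReal)) ∧
    (inducedTraceNorm (T - replacer σ) ≤ 1 / (2 * (dB : ℝ≥0∞)) →
      stabDivergence (Fin dA) T (replacer σ) ≤
        ((2 * (dB : ℝ≥0∞) ^ 5 / ENNReal.ofReal (minEigenvalue hσ.1.isHermitian) *
          inducedTraceNorm (T - replacer σ) ^ 2 : ℝ≥0∞) : EReal)) := by
  have hdB : dB ≠ 0 := by
    rintro rfl
    have h := hσ.2
    simp [Matrix.trace] at h
  constructor
  · intro h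
    -- Finiteness lets the extended norm be handled as a real number through `toReal`.
    have hN : inducedTraceNorm (idTensor (Fin dA) (T - replacer σ)) ≠ ⊤ :=
      (h.trans_lt (by simp)).ne
    have hb := blockBound_of_inducedTraceNorm_idTensor hN
    have := stabDivergence_replacer_le (c := 0) (hT.1 dA) hT.2 hσ hN
      eq_zero_of_inducedTraceNorm_eq_zero (by rwa [pow_zero, one_mul])
    simpa only [Fintype.card_fin] using this
  · intro h
    have hN : inducedTraceNorm (T - replacer σ) ≠ ⊤ := by
      refine (h.trans_lt (ENNReal.div_lt_top ENNReal.one_ne_top ?_)).ne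
      exact mul_ne_zero two_ne_zero (by exact_mod_cast hdB)
    have hb := blockBound_of_inducedTraceNorm (r := Fin dA) hN
    have := stabDivergence_replacer_le (c := 1) (hT.1 dA) hT.2 hσ hN
      (fun h0 => by rw [eq_zero_of_inducedTraceNorm_eq_zero h0]; rfl) (by rwa [pow_one])
    simpa only [Fintype.card_fin] using this
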